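/- Non-stationary dueling bandits: let $K\ge 2$ arms $a_1,\dots,a_K$, a horizon $T\in\mathbb N$ and $M\ge 1$ stationary segments $S_m=\{\nu_{m-1},\dots,\nu_m-1\}$, $1\le m\le M$, be given, where $1=\nu_0<\nu_1<\dots<\nu_{M-1}<\nu_M=T+1$. In segment $S_m$ arm $a_i$ beats $a_j$ in a duel with probability $p^{(m)}_{i,j}\in[0,1]$, where $p^{(m)}_{i,j}+p^{(m)}_{j,i}=1$, and there is a Condorcet winner $a_{m^*}$, i.e. $p^{(m)}_{m^*,i}>\frac12$ for all $i\ne m^*$. Put $\Delta^{(m)}_i:=p^{(m)}_{m^*,i}-\frac12$ and $\Delta:=\min_{1\le m\le M,\ i\ne m^*}\Delta^{(m)}_i$. In each time step $t\in S_m$ the learner plays a pair $(a_{I_t},a_{J_t})$ and observes $X^{(t)}_{I_t,J_t}\in\{0,1\}$ (equal to $1$ iff $a_{I_t}$ wins), where $X^{(t)}_{i,j}\sim\mathrm{Ber}(p^{(m)}_{i,j})$ for $t\in S_m$ and all $X^{(t)}_{i,j}$ are mutually independent. The cumulative binary weak regret is $$R^{\bar{\mathrm W}}(T):=\sum_{m=1}^M\sum_{t\in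 S_m}\big\lceil\min\{\Delta^{(m)}_{I_t},\Delta^{(m)}_{J_t}\}\big\rceil .$$ The algorithm Beat the Winner Reset (BtWR) with confidence parameter $\delta\in(0,1)$ uses the round lengths $\ell_c=\big\lceil\frac1{4\Delta^2}\log\frac{c(c+1)e}{\delta}-\frac12\big\rceil$, $c\ge1$. It draws an incumbent $a_I$ uniformly at random, puts the other arms in uniformly random order into a FIFO queue $Q$ (this randomness being independent of the duels), and sets $c=1$. It then proceeds in rounds. In each round the challenger $a_J$ is dequeued from $Q$ and the pair $(a_I,a_J)$ is played until one of the two arms has won $\ell_c$ duels of this round. If this is the incumbent, then $a_J$ is enqueued in $Q$ and $c$ is increased by $1$; otherwise $a_I$ is enqueued in $Q$, $a_J$ becomes the incumbent, and $c$ is reset to $1$. The algorithm uses neither $T$ nor $M$ nor the changepoints, and is stopped after time step $T$. **Theorem.** For $\delta=1/e$, the expected cumulative binary weak regret of BtWR satisfies $$\mathbb E\big[R^{\bar{\mathrm W}}(T)\big]\le\frac{21KM}{\Delta^2}\log(K+T).$$ -/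

import Mathlib

open MeasureTheory ProbabilityTheory

namespace DuelingBandits

/-- A non-stationary dueling bandits problem with arms `Fin K`, time steps `1, …, T` and `M`
stationary segments. -/
structure Problem (K M T : ℕ) where
  /-- The changepoints `ν 1 < ⋯ < ν (M - 1)`, with the dummies `ν 0 = 1` and `ν M = T + 1`. -/
  ν : Fin (M + 1) → ℕ
  ν_zero : ν 0 = 1
  ν_last : ν (Fin.last M) = T + 1
  ν_strictMono : StrictMono ν
  /-- `p m i j` is the probability that arm `i` wins a duel against arm `j` in segment `m`. -/
  p : Fin M → Fin K → Fin K → ℝ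
  p_mem : ∀ m i j, p m i j ∈ Set.Icc (0 : ℝ) 1
  p_add : ∀ m i j, p m i j + p m j i = 1
  /-- The Condorcet winner of each segment. -/
  best : Fin M → Fin K
  best_spec : ∀ m i, i ≠ best m → 1 / 2 < p m (best m) i

namespace Problem

variable {K M T : ℕ} (E : Problem K M T)

/-- The set of time steps of segment `m`. -/
def segment (m : Fin M) : Finset ℕ := Finset.Ico (E.ν m.castSucc) (E.ν m.succ)

/-- The suboptimality gap of arm `i` in segment `m`. -/
noncomputable def gap (m : Fin M) (i : Fin K) : ℝ := E.p m (E.best m) i - 1 / 2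

/-- The minimal suboptimality gap over all segments and all suboptimal arms (the minimum of a
finite family, which is nonempty when `1 ≤ M` and `2 ≤ K`). -/
noncomputable def minGap : ℝ :=
  ⨅ q : {q : Fin M × Fin K // q.2 ≠ E.best q.1}, E.gap q.1.1 q.1.2

/-- The binary weak regret of playing the pair `(i, j)` once in segment `m`. -/
noncomputable def binaryWeakRegret (m : Fin M) (i j : Fin K) : ℝ :=
  (⌈min (E.gap m i) (E.gap m j)⌉ : ℤ)

end Problem

/-- The round length `ℓ_c` for minimal gap `Δ` and confidence parameter `δ`. -/
noncomputable def roundLength (Δ δ : ℝ) (c : ℕ) : ℕ :=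
  ⌈1 / (4 * Δ ^ 2) * Real.log ((c : ℝ) * ((c : ℝ) + 1) * Real.exp 1 / δ) - 1 / 2⌉₊

/-- The internal state of Beat the Winner Reset just before a duel: the pair to be played, the
queue of the remaining arms, the round counter and the wins of both arms in the current round. -/
structure BtWRState (K : ℕ) where
  incumbent : Fin K
  challenger : Fin K
  queue : List (Fin K)
  c : ℕ
  winsI : ℕ
  winsJ : ℕ

namespace BtWRState

variable {K : ℕ}

/-- Start a round with incumbent `i` and round counter `c`, the challenger being dequeued from
`Q`. (The default `i` is never used: `Q` holds the other `K - 1` arms.) -/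
def startRound (i : Fin K) (Q : List (Fin K)) (c : ℕ) : BtWRState K :=
  ⟨i, Q.headD i, Q.tail, c, 0, 0⟩

/-- The update after one duel; `x = true` means that the incumbent has won the duel. The round
ends as soon as one of the two arms has `ℓ c` wins; the loser of the round is enqueued. -/
def step (ℓ : ℕ → ℕ) (s : BtWRState K) (x : Bool) : BtWRState K :=
  let wI := s.winsI + (if x = true then 1 else 0)
  let wJ := s.winsJ + (if x = false then 1 else 0)
  if wI < ℓ s.c ∧ wJ < ℓ s.c then
    { s with winsI := wI, winsJ := wJ }
  else if wI = ℓ s.c then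
    startRound s.incumbent (s.queue ++ [s.challenger]) (s.c + 1)
  else
    startRound s.challenger (s.queue ++ [s.incumbent]) 1

end BtWRState

/-- Beat the Winner Reset with round lengths `ℓ`, initial order `σ` of the arms (the incumbent
`σ 0`, then the queue) and duel outcomes `x t i j`: the state just before the duel of time step
`t + 1`. Only the outcomes of the pairs that are played enter. -/
def btwrAux {K : ℕ} (hK : 2 ≤ K) (ℓ : ℕ → ℕ) (σ : Equiv.Perm (Fin K))
    (x : ℕ → Fin K → Fin K → Bool) : ℕ → BtWRState K
  | 0 => BtWRState.startRound (σ ⟨0, by omega⟩) (List.ofFn σ).tail 1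
  | t + 1 =>
      let s := btwrAux hK ℓ σ x t
      s.step ℓ (x (t + 1) s.incumbent s.challenger)

/-- The state of Beat the Winner Reset just before the duel of time step `t ≥ 1`; the pair played
at time `t` consists of its incumbent and its challenger. -/
def btwr {K : ℕ} (hK : 2 ≤ K) (ℓ : ℕ → ℕ) (σ : Equiv.Perm (Fin K))
    (x : ℕ → Fin K → Fin K → Bool) (t : ℕ) : BtWRState K :=
  btwrAux hK ℓ σ x (t - 1)

/-- The cumulative binary weak regret `R(T)` of Beat the Winner Reset with round lengths `ℓ`. -/
noncomputable def Problem.btwrRegret {K M T : ℕ} (E : Problem K M T) (hK : 2 ≤ K) (ℓ : ℕ → ℕ)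
    (σ : Equiv.Perm (Fin K)) (x : ℕ → Fin K → Fin K → Bool) : ℝ :=
  ∑ m : Fin M, ∑ t ∈ E.segment m,
    E.binaryWeakRegret m (btwr hK ℓ σ x t).incumbent (btwr hK ℓ σ x t).challenger

/-- The discrete σ-algebra on the finite set of orders of the arms. -/
instance orderMeasurableSpace (K : ℕ) : MeasurableSpace (Equiv.Perm (Fin K)) := ⊤

/-- The probabilistic model: `X t i j` is the (Bernoulli) outcome of a duel of `i` against `j` at
time `t`, `true` if `i` wins, all of them mutually independent; `σ` is the order of the arms drawn
by the learner at the start, uniformly at random and independently of the duels. -/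
structure IsModel {K M T : ℕ} (E : Problem K M T) {Ω : Type*} [MeasurableSpace Ω]
    (μ : Measure Ω) (σ : Ω → Equiv.Perm (Fin K)) (X : ℕ → Fin K → Fin K → Ω → Bool) : Prop where
  measurable_X : ∀ t i j, Measurable (X t i j)
  law_X : ∀ m, ∀ t ∈ E.segment m, ∀ i j,
    μ {ω | X t i j ω = true} = ENNReal.ofReal (E.p m i j)
  indep_X : iIndepFun (fun (q : ℕ × Fin K × Fin K) => X q.1 q.2.1 q.2.2) μ
  measurable_order : Measurable σ
  law_order : ∀ τ, μ {ω | σ ω = τ} = ((K.factorial : ℕ) : ENNReal)⁻¹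
  indep_order : IndepFun σ (fun ω (q : ℕ × Fin K × Fin K) =>
    X q.1 q.2.1 q.2.2 ω) μ

end DuelingBandits

/-! Fix a segment with Condorcet winner `b`. A duel costs at most `1`, and nothing if `b` takes
part, so it suffices to count the duels without `b`. This is done with a potential on the
algorithm's states whose expected decrease in each duel is at least `1` if `b` is absent and at
least `0` otherwise (`potential_drift`).

With `d = 2Δ`, optional-stopping reasoning for a biased walk bounds the probability that `b` loses a
round with counter `c` by `(1 - d ^ 2) ^ ℓ c`, and the round lengths make this at most `1 /
(4c(c+1))` (`pow_roundLength_le`). These bounds telescope, so an incumbent `b` is ever dethroned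
with probability at most `1/4`, and an entering challenger `b` ever loses with probability at most
`1/8 + 1/4 = 3/8`. While `b` waits in the queue, at most `K - 2` rounds of at most `L` duels pass.
The cost `B` after a loss thus satisfies `B = (K - 2) L + 3/8 B`.

The potential is nonnegative and at most `5/4 B = 2 (K - 2) L` in every reachable state
(`potential_le`), so it does not matter which state the previous segment leaves behind. Since the
state before a duel is independent of that duel's outcomes, the drift carries over to expectations
(`integral_step_le`). It telescopes over the segment, and the bounds are summed over the `M`
segments. -/

namespace DuelingBandits

/-! ### Losing probability within one round -/

/-- An upper bound for the probability that the better arm loses a round in which it still needs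
`a` wins and the other arm still needs `b` wins, if it wins each duel with probability at least
`(1 + d) / 2`. -/
noncomputable def lossBound (d : ℝ) (a b : ℕ) : ℝ := min 1 ((1 + d) ^ a * (1 - d) ^ b)

section lossBound

variable {d : ℝ}

theorem lossBound_le_one (a b : ℕ) : lossBound d a b ≤ 1 := min_le_left _ _

theorem lossBound_nonneg (h0 : 0 ≤ d) (h1 : d ≤ 1) (a b : ℕ) : 0 ≤ lossBound d a b := by
  have : 0 ≤ 1 - d := by linarith
  unfold lossBound
  positivity

theorem lossBound_zero_right (h0 : 0 ≤ d) (a : ℕ) : lossBound d a 0 = 1 := by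
  have : (1 : ℝ) ≤ (1 + d) ^ a := one_le_pow₀ (by linarith)
  simp [lossBound, this]

theorem lossBound_self_le (n : ℕ) : lossBound d n n ≤ (1 - d ^ 2) ^ n := by
  refine (min_le_right _ _).trans (le_of_eq ?_)
  rw [← mul_pow]
  congr 1
  ring

/-- Supermartingale property of the exponential bound: `p (1 - d) + (1 - p) (1 + d)` is
nonincreasing in `p` and equals `1 - d ^ 2` at `p = (1 + d) / 2`. Truncation at `1` preserves it. -/
theorem lossBound_drift (h0 : 0 ≤ d) (h1 : d ≤ 1) {p : ℝ} (hp : (1 + d) / 2 ≤ p) (hp1 : p ≤ 1)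
    (a b : ℕ) :
    p * lossBound d a (b + 1) + (1 - p) * lossBound d (a + 1) b ≤
      lossBound d (a + 1) (b + 1) := by
  have hp0 : 0 ≤ p := by linarith
  have hq0 : 0 ≤ 1 - p := by linarith
  refine le_min ?_ ?_
  · have := mul_le_mul_of_nonneg_left (lossBound_le_one (d := d) a (b + 1)) hp0
    have := mul_le_mul_of_nonneg_left (lossBound_le_one (d := d) (a + 1) b) hq0
    linarith
  · have e1 := mul_le_mul_of_nonneg_left
      (min_le_right 1 ((1 + d) ^ a * (1 - d) ^ (b + 1))) hp0
    have e2 := mul_le_mul_of_nonneg_left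
      (min_le_right 1 ((1 + d) ^ (a + 1) * (1 - d) ^ b)) hq0
    have hd : 0 ≤ 1 - d := by linarith
    have h3 : 0 ≤ (1 + d) ^ a * (1 - d) ^ b := by positivity
    have h4 : p * (1 - d) + (1 - p) * (1 + d) ≤ (1 + d) * (1 - d) := by nlinarith
    have h5 := mul_le_mul_of_nonneg_left h4 h3
    unfold lossBound
    calc _ ≤ _ := add_le_add e1 e2
      _ = (1 + d) ^ a * (1 - d) ^ b * (p * (1 - d) + (1 - p) * (1 + d)) := by ring
      _ ≤ _ := h5
      _ = _ := by ring

end lossBound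

/-! ### Reachable states and their transitions -/

namespace BtWRState

variable {K : ℕ}

/-- The reachable states of Beat the Winner Reset whose round counter is at most `N`. -/
structure Valid (ℓ : ℕ → ℕ) (N : ℕ) (s : BtWRState K) : Prop where
  nodup : (s.incumbent :: s.challenger :: s.queue).Nodup
  length_queue : s.queue.length + 2 = K
  one_le_c : 1 ≤ s.c
  c_le : s.c ≤ N
  winsI_lt : s.winsI < ℓ s.c
  winsJ_lt : s.winsJ < ℓ s.c

variable {ℓ : ℕ → ℕ} {N : ℕ}

theorem Valid.mem {s : BtWRState K} (hs : s.Valid ℓ N) (i : Fin K) :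
    i = s.incumbent ∨ i = s.challenger ∨ i ∈ s.queue := by
  have h1 : (s.incumbent :: s.challenger :: s.queue).toFinset = Finset.univ := by
    apply Finset.eq_univ_of_card
    rw [List.toFinset_card_of_nodup hs.nodup]
    simpa using hs.length_queue
  have h2 : i ∈ (s.incumbent :: s.challenger :: s.queue).toFinset := by simp [h1]
  simpa using h2

theorem valid_startRound (hℓ : ∀ c, 1 ≤ c → 0 < ℓ c) {i : Fin K} {Q : List (Fin K)} {c : ℕ}
    (hQ : (i :: Q).Nodup) (hlen : Q.length + 1 = K) (hK : 2 ≤ K) (hc : 1 ≤ c) (hcN : c ≤ N) :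
    (startRound i Q c).Valid ℓ N := by
  cases Q with
  | nil => simp at hlen; omega
  | cons j Q =>
    exact ⟨by simpa [startRound] using hQ, by simpa [startRound] using hlen, hc, hcN,
      hℓ c hc, hℓ c hc⟩

theorem step_true_of_lt {s : BtWRState K} (hJ : s.winsJ < ℓ s.c) (h : s.winsI + 1 < ℓ s.c) :
    s.step ℓ true = { s with winsI := s.winsI + 1 } := by
  simp [step, hJ, h]

theorem step_true_of_eq {s : BtWRState K} (h : s.winsI + 1 = ℓ s.c) :
    s.step ℓ true = startRound s.incumbent (s.queue ++ [s.challenger]) (s.c + 1) := by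
  simp [step, h]

theorem step_false_of_lt {s : BtWRState K} (hI : s.winsI < ℓ s.c) (h : s.winsJ + 1 < ℓ s.c) :
    s.step ℓ false = { s with winsJ := s.winsJ + 1 } := by
  simp [step, hI, h]

theorem step_false_of_eq {s : BtWRState K} (hI : s.winsI < ℓ s.c) (h : s.winsJ + 1 = ℓ s.c) :
    s.step ℓ false = startRound s.challenger (s.queue ++ [s.incumbent]) 1 := by
  simp [step, h, hI.ne]

theorem Valid.step (hℓ : ∀ c, 1 ≤ c → 0 < ℓ c) {s : BtWRState K} (hs : s.Valid ℓ N) (x : Bool) :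
    (s.step ℓ x).Valid ℓ (N + 1) := by
  obtain ⟨h1, h2, h3, h4, h5, h6⟩ := hs
  have hK : 2 ≤ K := by omega
  cases x
  · rcases Nat.lt_or_ge (s.winsJ + 1) (ℓ s.c) with h | h
    · rw [step_false_of_lt h5 h]
      exact ⟨h1, h2, h3, Nat.le_succ_of_le h4, h5, h⟩
    · rw [step_false_of_eq h5 (by omega)]
      refine valid_startRound hℓ ?_ (by simp; omega) hK le_rfl (by omega)
      have : (s.challenger :: (s.queue ++ [s.incumbent])).Perm
          (s.incumbent :: s.challenger :: s.queue) :=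
        (List.Perm.cons _ List.perm_append_comm).trans (List.Perm.swap _ _ _)
      exact this.nodup_iff.2 h1
  · rcases Nat.lt_or_ge (s.winsI + 1) (ℓ s.c) with h | h
    · rw [step_true_of_lt h6 h]
      exact ⟨h1, h2, h3, Nat.le_succ_of_le h4, h, h6⟩
    · rw [step_true_of_eq (by omega)]
      refine valid_startRound hℓ ?_ (by simp; omega) hK (by omega) (by omega)
      have : (s.incumbent :: (s.queue ++ [s.challenger])).Perm
          (s.incumbent :: s.challenger :: s.queue) :=
        List.Perm.cons _ List.perm_append_comm
      exact this.nodup_iff.2 h1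

/-! ### The potential and its drift -/

/-- A potential that bounds the expected number of future duels without the arm `b`, if `b` wins
each duel with probability at least `(1 + d) / 2`, a round takes at most `L` duels, and `B` bounds
the potential after a round lost by `b`. -/
noncomputable def potential (ℓ : ℕ → ℕ) (d L B : ℝ) (b : Fin K) (s : BtWRState K) : ℝ :=
  if s.incumbent = b then
    B * (1 / (4 * (s.c + 1)) + lossBound d (ℓ s.c - s.winsI) (ℓ s.c - s.winsJ))
  else if s.challenger = b then
    B * (1 / 4 + lossBound d (ℓ s.c - s.winsJ) (ℓ s.c - s.winsI))
  else (2 * ℓ s.c - 1 - s.winsI - s.winsJ) + s.queue.idxOf b * L + 3 / 8 * B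

/-- The duels without the arm `b`. -/
noncomputable def misses (b : Fin K) (s : BtWRState K) : ℝ :=
  if s.incumbent = b ∨ s.challenger = b then 0 else 1

section potential

variable {d L B : ℝ} {b : Fin K}

/-- The telescoping identity `1/(4(c+1)) + 1/(4c(c+1)) = 1/(4c)`: the failure bound of this round
plus that of all later rounds. -/
theorem potential_startRound_best (hB : 0 ≤ B)
    (hε : ∀ c, 1 ≤ c → (1 - d ^ 2) ^ ℓ c ≤ 1 / (4 * (c * (c + 1)))) (Q : List (Fin K)) {c : ℕ}
    (hc : 1 ≤ c) : potential ℓ d L B b (startRound b Q c) ≤ B * (1 / (4 * c)) := by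
  simp only [potential, startRound, if_true, Nat.sub_zero]
  refine mul_le_mul_of_nonneg_left ?_ hB
  have hc' : (0 : ℝ) < c := by exact_mod_cast hc
  have := (lossBound_self_le (d := d) (ℓ c)).trans (hε c hc)
  calc _ ≤ 1 / (4 * ((c : ℝ) + 1)) + 1 / (4 * (c * (c + 1))) := by linarith
    _ = _ := by field_simp

/-- If `b` is the new challenger, its value is at most `B (1/4 + 1/8)`, because `c (c + 1) ≥ 2`;
this is the origin of `3/8`. Otherwise the new round uses up one of the `L`'s counted by the
position of `b`. -/
theorem potential_startRound_le (hB : 0 ≤ B)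
    (hε : ∀ c, 1 ≤ c → (1 - d ^ 2) ^ ℓ c ≤ 1 / (4 * (c * (c + 1))))
    (hL : ∀ c, c ≤ N → 2 * (ℓ c : ℝ) - 1 ≤ L) {i : Fin K} {Q : List (Fin K)} {c : ℕ}
    (hi : i ≠ b) (hb : b ∈ Q) (hc : 1 ≤ c) (hcN : c ≤ N) :
    potential ℓ d L B b (startRound i Q c) ≤ Q.idxOf b * L + 3 / 8 * B := by
  cases Q with
  | nil => simp at hb
  | cons j Q =>
    by_cases hj : j = b
    · subst hj
      simp only [potential, startRound, List.headD_cons, if_neg hi, if_true, Nat.sub_zero,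
        List.idxOf_cons_self, Nat.cast_zero, zero_mul, zero_add]
      rw [mul_comm]
      refine mul_le_mul_of_nonneg_right ?_ hB
      have h1 := (lossBound_self_le (d := d) (ℓ c)).trans (hε c hc)
      have hc' : (1 : ℝ) ≤ c := by exact_mod_cast hc
      have h2 : (1 : ℝ) / (4 * (c * (c + 1))) ≤ 1 / 8 :=
        one_div_le_one_div_of_le (by norm_num) (by nlinarith)
      linarith
    · simp only [potential, startRound, List.headD_cons, if_neg hi, if_neg hj, List.tail_cons,
        Nat.cast_zero, sub_zero, List.idxOf_cons_ne _ hj, Nat.cast_succ]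
      have := hL c hcN
      linarith

/-- The drift of the potential in one duel. -/
theorem potential_drift (hd0 : 0 ≤ d) (hd1 : d ≤ 1) (hL0 : 0 ≤ L)
    (hB : B = 8 / 5 * (((K : ℝ) - 2) * L))
    (hε : ∀ c, 1 ≤ c → (1 - d ^ 2) ^ ℓ c ≤ 1 / (4 * (c * (c + 1))))
    (hL : ∀ c, c ≤ N + 1 → 2 * (ℓ c : ℝ) - 1 ≤ L)
    {p : Fin K → Fin K → ℝ} (hp : ∀ i j, p i j ∈ Set.Icc (0 : ℝ) 1)
    (hp_add : ∀ i j, p i j + p j i = 1) (hp_best : ∀ i, i ≠ b → (1 + d) / 2 ≤ p b i)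
    {s : BtWRState K} (hs : s.Valid ℓ N) :
    p s.incumbent s.challenger * potential ℓ d L B b (s.step ℓ true) +
        (1 - p s.incumbent s.challenger) * potential ℓ d L B b (s.step ℓ false) ≤
      potential ℓ d L B b s - misses b s := by
  have hKlen : ((s.queue.length : ℕ) : ℝ) = (K : ℝ) - 2 :=
    eq_sub_of_add_eq (by exact_mod_cast hs.length_queue)
  have hB0 : 0 ≤ B := by
    rw [hB, ← hKlen]
    positivity
  have hc := hs.one_le_c
  have hcN := hs.c_le
  have hI := hs.winsI_lt
  have hJ := hs.winsJ_lt
  have hnd := hs.nodup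
  simp only [List.nodup_cons, List.mem_cons, not_or] at hnd
  obtain ⟨⟨hIJ, hIQ⟩, hJQ, -⟩ := hnd
  -- After a loss `b` is last in the queue, at index `K - 2`; the factor `8/5` in `B` solves `(K -
  -- 2) L + 3/8 B = B`.
  have hlost : ∀ (i : Fin K) (c : ℕ), i ≠ b → b ∉ s.queue → 1 ≤ c → c ≤ N + 1 →
      potential ℓ d L B b (startRound i (s.queue ++ [b]) c) ≤ B := by
    intro i c hi hb hc hcN
    refine (potential_startRound_le hB0 hε hL hi (by simp) hc hcN).trans (le_of_eq ?_)
    rw [List.idxOf_append_of_notMem hb]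
    simp only [List.idxOf_cons_self, add_zero, hKlen]
    rw [hB]
    ring
  obtain ⟨a, ha⟩ : ∃ a, ℓ s.c - s.winsI = a + 1 := ⟨ℓ s.c - s.winsI - 1, by omega⟩
  obtain ⟨e, he⟩ : ∃ e, ℓ s.c - s.winsJ = e + 1 := ⟨ℓ s.c - s.winsJ - 1, by omega⟩
  have hp0 := (hp s.incumbent s.challenger).1
  have hp1 := (hp s.incumbent s.challenger).2
  by_cases hbI : s.incumbent = b
  · have hm : misses b s = 0 := by simp [misses, hbI]
    have hs0 : potential ℓ d L B b s =
        B * (1 / (4 * (s.c + 1)) + lossBound d (a + 1) (e + 1)) := by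
      simp [potential, hbI, ha, he]
    have ht : potential ℓ d L B b (s.step ℓ true) ≤
        B * (1 / (4 * (s.c + 1)) + lossBound d a (e + 1)) := by
      rcases Nat.lt_or_ge (s.winsI + 1) (ℓ s.c) with h | h
      · rw [step_true_of_lt hJ h]
        have : ℓ s.c - (s.winsI + 1) = a := by omega
        simp [potential, hbI, this, he]
      · rw [step_true_of_eq (by omega), hbI]
        refine (potential_startRound_best hB0 hε _ (by omega)).trans ?_
        refine mul_le_mul_of_nonneg_left ?_ hB0
        have := lossBound_nonneg hd0 hd1 a (e + 1)
        push_cast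
        linarith
    have hf : potential ℓ d L B b (s.step ℓ false) ≤
        B * (1 / (4 * (s.c + 1)) + lossBound d (a + 1) e) := by
      rcases Nat.lt_or_ge (s.winsJ + 1) (ℓ s.c) with h | h
      · rw [step_false_of_lt hI h]
        have : ℓ s.c - (s.winsJ + 1) = e := by omega
        simp [potential, hbI, this, ha]
      · rw [step_false_of_eq hI (by omega), hbI]
        have he0 : e = 0 := by omega
        refine (hlost _ _ (by rw [← hbI]; exact fun h => hIJ h.symm) (by rwa [← hbI])
          le_rfl (by omega)).trans ?_
        -- The round is lost, so the loss bound equals `1` and the right-hand side is at least `B`.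
        rw [he0, lossBound_zero_right hd0]
        have : (0 : ℝ) ≤ 1 / (4 * (s.c + 1)) := by positivity
        nlinarith
    have hpb : (1 + d) / 2 ≤ p s.incumbent s.challenger := by
      rw [hbI]
      exact hp_best _ (by rw [← hbI]; exact fun h => hIJ h.symm)
    have h1 := mul_le_mul_of_nonneg_left ht hp0
    have h2 := mul_le_mul_of_nonneg_left hf (sub_nonneg.2 hp1)
    have h3 := mul_le_mul_of_nonneg_left (lossBound_drift hd0 hd1 hpb hp1 a e) hB0
    rw [hm, hs0]
    linarith
  by_cases hbJ : s.challenger = b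
  · have hm : misses b s = 0 := by simp [misses, hbJ]
    have hs0 : potential ℓ d L B b s = B * (1 / 4 + lossBound d (e + 1) (a + 1)) := by
      simp [potential, hbI, hbJ, ha, he]
    have hf : potential ℓ d L B b (s.step ℓ false) ≤
        B * (1 / 4 + lossBound d e (a + 1)) := by
      rcases Nat.lt_or_ge (s.winsJ + 1) (ℓ s.c) with h | h
      · rw [step_false_of_lt hI h]
        have : ℓ s.c - (s.winsJ + 1) = e := by omega
        simp [potential, hbI, hbJ, this, ha]
      · rw [step_false_of_eq hI (by omega), hbJ]
        refine (potential_startRound_best hB0 hε _ le_rfl).trans ?_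
        refine mul_le_mul_of_nonneg_left ?_ hB0
        have := lossBound_nonneg hd0 hd1 e (a + 1)
        push_cast
        linarith
    have ht : potential ℓ d L B b (s.step ℓ true) ≤
        B * (1 / 4 + lossBound d (e + 1) a) := by
      rcases Nat.lt_or_ge (s.winsI + 1) (ℓ s.c) with h | h
      · rw [step_true_of_lt hJ h]
        have : ℓ s.c - (s.winsI + 1) = a := by omega
        simp [potential, hbI, hbJ, this, he]
      · rw [step_true_of_eq (by omega), hbJ]
        have ha0 : a = 0 := by omega
        refine (hlost _ _ hbI (by rwa [← hbJ]) (by omega) (by omega)).trans ?_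
        rw [ha0, lossBound_zero_right hd0]
        linarith
    have hpa := hp_add s.incumbent s.challenger
    have hpb : (1 + d) / 2 ≤ p s.challenger s.incumbent := by
      rw [hbJ]
      exact hp_best _ hbI
    have hq1 := (hp s.challenger s.incumbent).2
    have h1 := mul_le_mul_of_nonneg_left ht hp0
    have h2 := mul_le_mul_of_nonneg_left hf (sub_nonneg.2 hp1)
    have h3 := mul_le_mul_of_nonneg_left (lossBound_drift hd0 hd1 hpb hq1 e a) hB0
    have hpe : p s.challenger s.incumbent = 1 - p s.incumbent s.challenger := by linarith
    rw [hpe] at h3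
    rw [hm, hs0]
    linarith
  · have hbQ : b ∈ s.queue := by
      rcases hs.mem b with h | h | h
      · exact absurd h.symm hbI
      · exact absurd h.symm hbJ
      · exact h
    have hm : misses b s = 1 := by simp [misses, hbI, hbJ]
    have hs0 : potential ℓ d L B b s =
        (2 * ℓ s.c - 1 - s.winsI - s.winsJ) + s.queue.idxOf b * L + 3 / 8 * B := by
      simp [potential, hbI, hbJ]
    have hI' : (s.winsI : ℝ) + 1 ≤ ℓ s.c := by exact_mod_cast hI
    have hJ' : (s.winsJ : ℝ) + 1 ≤ ℓ s.c := by exact_mod_cast hJ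
    have hidx : ∀ i, (s.queue ++ [i]).idxOf b = s.queue.idxOf b := fun i =>
      List.idxOf_append_of_mem hbQ
    -- Without `b` the decrease by `1` holds for either outcome: a duel is used up in the current
    -- round, or the round ends and `b` moves up by one place.
    have ht : potential ℓ d L B b (s.step ℓ true) ≤ potential ℓ d L B b s - 1 := by
      rw [hs0]
      rcases Nat.lt_or_ge (s.winsI + 1) (ℓ s.c) with h | h
      · rw [step_true_of_lt hJ h]
        simp only [potential, hbI, hbJ, if_false]
        push_cast
        linarith
      · rw [step_true_of_eq (by omega)]
        refine (potential_startRound_le hB0 hε hL hbI (by simp [hbQ]) (by omega)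
          (by omega)).trans ?_
        rw [hidx]
        linarith
    have hf : potential ℓ d L B b (s.step ℓ false) ≤ potential ℓ d L B b s - 1 := by
      rw [hs0]
      rcases Nat.lt_or_ge (s.winsJ + 1) (ℓ s.c) with h | h
      · rw [step_false_of_lt hI h]
        simp only [potential, hbI, hbJ, if_false]
        push_cast
        linarith
      · rw [step_false_of_eq hI (by omega)]
        refine (potential_startRound_le hB0 hε hL hbJ (by simp [hbQ]) le_rfl
          (by omega)).trans ?_
        rw [hidx]
        linarith
    have h1 := mul_le_mul_of_nonneg_left ht hp0
    have h2 := mul_le_mul_of_nonneg_left hf (sub_nonneg.2 hp1)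
    rw [hm]
    linarith

theorem potential_nonneg (hd0 : 0 ≤ d) (hd1 : d ≤ 1) (hL0 : 0 ≤ L) (hB0 : 0 ≤ B)
    {s : BtWRState K} (hs : s.Valid ℓ N) : 0 ≤ potential ℓ d L B b s := by
  have hI' : (s.winsI : ℝ) + 1 ≤ ℓ s.c := by exact_mod_cast hs.winsI_lt
  have hJ' : (s.winsJ : ℝ) + 1 ≤ ℓ s.c := by exact_mod_cast hs.winsJ_lt
  have h1 := lossBound_nonneg hd0 hd1 (ℓ s.c - s.winsI) (ℓ s.c - s.winsJ)
  have h2 := lossBound_nonneg hd0 hd1 (ℓ s.c - s.winsJ) (ℓ s.c - s.winsI)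
  have h3 : (0 : ℝ) ≤ 2 * ℓ s.c - 1 - s.winsI - s.winsJ := by linarith
  unfold potential
  split_ifs <;> positivity

theorem potential_le (hL0 : 0 ≤ L) (hB : B = 8 / 5 * (((K : ℝ) - 2) * L))
    (hL : ∀ c, c ≤ N → 2 * (ℓ c : ℝ) - 1 ≤ L) {s : BtWRState K} (hs : s.Valid ℓ N) :
    potential ℓ d L B b s ≤ 2 * (((K : ℝ) - 2) * L) := by
  have hKlen : ((s.queue.length : ℕ) : ℝ) = (K : ℝ) - 2 :=
    eq_sub_of_add_eq (by exact_mod_cast hs.length_queue)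
  have hB0 : 0 ≤ B := by
    rw [hB, ← hKlen]
    positivity
  -- The value `5/4 = 1/4 + 1` is what the cases with `b` playing need; a waiting `b` costs at most
  -- `B`.
  have hB' : 2 * (((K : ℝ) - 2) * L) = B * (5 / 4) := by
    rw [hB]
    ring
  rw [hB']
  unfold potential
  split_ifs with h1 h2
  · refine mul_le_mul_of_nonneg_left ?_ hB0
    have := lossBound_le_one (d := d) (ℓ s.c - s.winsI) (ℓ s.c - s.winsJ)
    have h3 : (1 : ℝ) / (4 * (s.c + 1)) ≤ 1 / 4 :=
      one_div_le_one_div_of_le (by norm_num) (by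
        have : (0 : ℝ) ≤ s.c := by positivity
        linarith)
    linarith
  · refine mul_le_mul_of_nonneg_left ?_ hB0
    have := lossBound_le_one (d := d) (ℓ s.c - s.winsJ) (ℓ s.c - s.winsI)
    linarith
  · have hbQ : b ∈ s.queue := by
      rcases hs.mem b with h | h | h
      · exact absurd h.symm h1
      · exact absurd h.symm h2
      · exact h
    have h3 : ((s.queue.idxOf b : ℕ) : ℝ) + 1 ≤ s.queue.length := by
      exact_mod_cast List.idxOf_lt_length_iff.2 hbQ
    have h4 := hL s.c hs.c_le
    have h5 := mul_le_mul_of_nonneg_right h3 hL0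
    rw [hKlen] at h5
    have : (0 : ℝ) ≤ s.winsI := by positivity
    have : (0 : ℝ) ≤ s.winsJ := by positivity
    linarith

end potential

end BtWRState

/-! ### Invariants along a run -/

theorem valid_btwrAux {K : ℕ} (hK : 2 ≤ K) {ℓ : ℕ → ℕ} (hℓ : ∀ c, 1 ≤ c → 0 < ℓ c)
    (σ : Equiv.Perm (Fin K)) (x : ℕ → Fin K → Fin K → Bool) (t : ℕ) :
    (btwrAux hK ℓ σ x t).Valid ℓ (t + 1) := by
  induction t with
  | zero =>
    refine BtWRState.valid_startRound hℓ ?_ (by simp; omega) hK le_rfl le_rfl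
    obtain ⟨n, rfl⟩ : ∃ n, K = n + 1 := ⟨K - 1, by omega⟩
    have h : (List.ofFn σ).Nodup := List.nodup_ofFn.2 σ.injective
    rw [List.ofFn_succ] at h ⊢
    exact h
  | succ t ih => exact ih.step hℓ _

theorem btwrAux_congr {K : ℕ} (hK : 2 ≤ K) (ℓ : ℕ → ℕ) (σ : Equiv.Perm (Fin K))
    {x y : ℕ → Fin K → Fin K → Bool} {t : ℕ} (h : ∀ s ≤ t, x s = y s) :
    btwrAux hK ℓ σ x t = btwrAux hK ℓ σ y t := by
  induction t with
  | zero => rfl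
  | succ t ih =>
    simp only [btwrAux]
    rw [ih fun s hs => h s (by omega), h (t + 1) le_rfl]

end DuelingBandits
namespace DuelingBandits

/-! ### Independence and freezing -/

section Independence

variable {Ω : Type*} [MeasurableSpace Ω] {μ : Measure Ω} [IsProbabilityMeasure μ]

theorem indepFun_prodMk_left {α β γ : Type*} [MeasurableSpace α] [MeasurableSpace β]
    [MeasurableSpace γ] {f : Ω → α} {g : Ω → β} {h : Ω → γ} (hf : Measurable f)
    (hg : Measurable g) (hh : Measurable h) (h1 : IndepFun f (fun ω => (g ω, h ω)) μ)
    (h2 : IndepFun g h μ) : IndepFun (fun ω => (f ω, g ω)) h μ := by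
  have : IsProbabilityMeasure (μ.map f) := Measure.isProbabilityMeasure_map hf.aemeasurable
  have : IsProbabilityMeasure (μ.map g) := Measure.isProbabilityMeasure_map hg.aemeasurable
  have : IsProbabilityMeasure (μ.map h) := Measure.isProbabilityMeasure_map hh.aemeasurable
  have hfg : IndepFun f g μ := h1.comp measurable_id measurable_fst
  rw [indepFun_iff_map_prod_eq_prod_map_map (by fun_prop) (by fun_prop)] at h1 h2 hfg ⊢
  rw [hfg, ← MeasurableEquiv.prodAssoc.map_measurableEquiv_injective.eq_iff,
    (measurePreserving_prodAssoc _ _ _).map_eq, ← h2, ← h1,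
    Measure.map_map (by fun_prop) (by fun_prop)]
  rfl

/-- Fubini for the product law: the first variable may be frozen while integrating over the second.
Finiteness of the value types settles all measurability and integrability. -/
theorem integral_comp_of_indepFun {α β : Type*} [MeasurableSpace α] [MeasurableSpace β]
    [Finite α] [Finite β] [MeasurableSingletonClass α] [MeasurableSingletonClass β]
    {f : Ω → α} {g : Ω → β} (hf : Measurable f) (hg : Measurable g) (h : IndepFun f g μ)
    (φ : α → β → ℝ) :
    ∫ ω, φ (f ω) (g ω) ∂μ = ∫ ω, ∫ ω', φ (f ω) (g ω') ∂μ ∂μ := by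
  have : IsProbabilityMeasure (μ.map f) := Measure.isProbabilityMeasure_map hf.aemeasurable
  have : IsProbabilityMeasure (μ.map g) := Measure.isProbabilityMeasure_map hg.aemeasurable
  have e1 : ∫ ω, φ (f ω) (g ω) ∂μ =
      ∫ q, φ q.1 q.2 ∂(μ.map fun ω => (f ω, g ω)) :=
    (integral_map (f := fun q : α × β => φ q.1 q.2) (hf.prodMk hg).aemeasurable
      AEStronglyMeasurable.of_discrete).symm
  have e2 : ∀ a, ∫ ω', φ a (g ω') ∂μ = ∫ b, φ a b ∂(μ.map g) := fun a =>
    (integral_map hg.aemeasurable AEStronglyMeasurable.of_discrete).symm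
  rw [e1, (indepFun_iff_map_prod_eq_prod_map_map hf.aemeasurable hg.aemeasurable).1 h,
    integral_prod _ Integrable.of_finite,
    integral_map hf.aemeasurable AEStronglyMeasurable.of_discrete]
  simp only [e2]

theorem integral_comp_bool {x : Ω → Bool} (hx : Measurable x) {p : ℝ} (hp : 0 ≤ p)
    (hlaw : μ {ω | x ω = true} = ENNReal.ofReal p) (φ : Bool → ℝ) :
    ∫ ω, φ (x ω) ∂μ = p * φ true + (1 - p) * φ false := by
  have hs : MeasurableSet {ω | x ω = true} := hx (measurableSet_singleton true)
  have h1 : ∀ ω, φ (x ω) =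
      {ω | x ω = true}.indicator (fun _ => φ true - φ false) ω + φ false := by
    intro ω
    cases h : x ω <;> simp [Set.indicator, h]
  simp_rw [h1]
  rw [integral_add ((integrable_const _).indicator hs) (integrable_const _),
    integral_indicator_const _ hs, Measure.real, hlaw, ENNReal.toReal_ofReal hp]
  simp
  ring

end Independence

/-! ### Expected one-step drift in the model -/

section Model

variable {K M T : ℕ} {E : Problem K M T} {Ω : Type*} [MeasurableSpace Ω] {μ : Measure Ω}
  {σ : Ω → Equiv.Perm (Fin K)} {X : ℕ → Fin K → Fin K → Ω → Bool}

/-- The duels up to time `t`. -/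
def pastDuels (K t : ℕ) : Finset (ℕ × Fin K × Fin K) := Finset.range (t + 1) ×ˢ Finset.univ

/-- The duels at time `t`. -/
def duelsAt (K t : ℕ) : Finset (ℕ × Fin K × Fin K) := {t} ×ˢ Finset.univ

/-- The restriction of the duel outcomes to a finite set of duels. -/
def outcomes (X : ℕ → Fin K → Fin K → Ω → Bool) (A : Finset (ℕ × Fin K × Fin K)) (ω : Ω)
    (q : A) : Bool := X q.1.1 q.1.2.1 q.1.2.2 ω

/-- The duel outcomes that agree with `y` on `A` and are lost by the first arm elsewhere. -/
def extendOutcomes (A : Finset (ℕ × Fin K × Fin K)) (y : A → Bool) (t : ℕ) (i j : Fin K) : Bool :=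
  if h : (t, i, j) ∈ A then y ⟨_, h⟩ else false

/-- The state factors through finitely many bits, so any real function of it is measurable and
integrable although the states carry no σ-algebra. -/
theorem btwrAux_extendOutcomes {K : ℕ} {Ω : Type*} {X : ℕ → Fin K → Fin K → Ω → Bool} (hK : 2 ≤ K)
    (ℓ : ℕ → ℕ) (τ : Equiv.Perm (Fin K)) (t : ℕ) (ω : Ω) :
    btwrAux hK ℓ τ (extendOutcomes _ (outcomes X (pastDuels K t) ω)) t =
      btwrAux hK ℓ τ (fun s i j => X s i j ω) t := by
  refine btwrAux_congr hK ℓ τ fun s hs => ?_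
  funext i j
  have : (s, i, j) ∈ pastDuels K t := by simp [pastDuels]; omega
  simp [extendOutcomes, outcomes, this]

theorem measurable_outcomes (hmodel : IsModel E μ σ X) (A : Finset (ℕ × Fin K × Fin K)) :
    Measurable (outcomes X A) :=
  measurable_pi_lambda _ fun _ => hmodel.measurable_X _ _ _

instance : DiscreteMeasurableSpace (Equiv.Perm (Fin K)) := ⟨fun _ => trivial⟩

variable [IsProbabilityMeasure μ]

theorem IsModel.indepFun_past (hmodel : IsModel E μ σ X) (t : ℕ) :
    IndepFun (fun ω => (σ ω, outcomes X (pastDuels K t) ω)) (outcomes X (duelsAt K (t + 1))) μ := by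
  refine indepFun_prodMk_left hmodel.measurable_order (measurable_outcomes hmodel _)
    (measurable_outcomes hmodel _) ?_ ?_
  · refine hmodel.indep_order.comp measurable_id (ψ := fun x =>
      (fun q : pastDuels K t => x q.1, fun q : duelsAt K (t + 1) => x q.1)) ?_
    exact (measurable_pi_lambda _ fun _ => measurable_pi_apply _).prodMk
      (measurable_pi_lambda _ fun _ => measurable_pi_apply _)
  · refine hmodel.indep_X.indepFun_finset (pastDuels K t) (duelsAt K (t + 1)) ?_
      fun _ => hmodel.measurable_X _ _ _
    rw [Finset.disjoint_left]
    rintro ⟨s, i, j⟩ h1 h2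
    simp [pastDuels, duelsAt] at h1 h2
    omega

theorem IsModel.integrable_btwrAux (hmodel : IsModel E μ σ X) (hK : 2 ≤ K) (ℓ : ℕ → ℕ)
    (V : BtWRState K → ℝ) (t : ℕ) :
    Integrable (fun ω => V (btwrAux hK ℓ (σ ω) (fun s i j => X s i j ω) t)) μ := by
  have hU : Measurable fun ω => (σ ω, outcomes X (pastDuels K t) ω) :=
    hmodel.measurable_order.prodMk (measurable_outcomes hmodel _)
  have : IsProbabilityMeasure (μ.map fun ω => (σ ω, outcomes X (pastDuels K t) ω)) :=
    Measure.isProbabilityMeasure_map hU.aemeasurable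
  have h : Integrable (fun q : Equiv.Perm (Fin K) × (pastDuels K t → Bool) =>
      V (btwrAux hK ℓ q.1 (extendOutcomes _ q.2) t))
      (μ.map fun ω => (σ ω, outcomes X (pastDuels K t) ω)) := Integrable.of_finite
  refine (h.comp_measurable hU).congr (Filter.Eventually.of_forall fun ω => ?_)
  simp only [Function.comp_apply, btwrAux_extendOutcomes]

theorem IsModel.integral_step_le (hmodel : IsModel E μ σ X) (hK : 2 ≤ K) {ℓ : ℕ → ℕ}
    {V r : BtWRState K → ℝ} {m : Fin M} {t : ℕ} (ht : t + 1 ∈ E.segment m)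
    (hdrift : ∀ τ x, let s := btwrAux hK ℓ τ x t
      E.p m s.incumbent s.challenger * V (s.step ℓ true) +
        (1 - E.p m s.incumbent s.challenger) * V (s.step ℓ false) ≤ V s - r s) :
    ∫ ω, V (btwrAux hK ℓ (σ ω) (fun s i j => X s i j ω) (t + 1)) ∂μ +
        ∫ ω, r (btwrAux hK ℓ (σ ω) (fun s i j => X s i j ω) t) ∂μ ≤
      ∫ ω, V (btwrAux hK ℓ (σ ω) (fun s i j => X s i j ω) t) ∂μ := by
  have hU : Measurable fun ω => (σ ω, outcomes X (pastDuels K t) ω) :=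
    hmodel.measurable_order.prodMk (measurable_outcomes hmodel _)
  let S : Equiv.Perm (Fin K) × (pastDuels K t → Bool) → BtWRState K := fun q =>
    btwrAux hK ℓ q.1 (extendOutcomes _ q.2) t
  have hmem : ∀ i j : Fin K, (t + 1, i, j) ∈ duelsAt K (t + 1) := by simp [duelsAt]
  -- The past `q` selects which coordinate of the present outcomes `z` is read; once `q` is frozen,
  -- it is a single Bernoulli variable.
  let φ : Equiv.Perm (Fin K) × (pastDuels K t → Bool) → (duelsAt K (t + 1) → Bool) → ℝ :=
    fun q z => V ((S q).step ℓ (z ⟨_, hmem (S q).incumbent (S q).challenger⟩))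
  have hS : ∀ ω, S (σ ω, outcomes X (pastDuels K t) ω) =
      btwrAux hK ℓ (σ ω) (fun s i j => X s i j ω) t := fun ω => btwrAux_extendOutcomes _ _ _ _ _
  have e1 : ∫ ω, V (btwrAux hK ℓ (σ ω) (fun s i j => X s i j ω) (t + 1)) ∂μ =
      ∫ ω, φ (σ ω, outcomes X (pastDuels K t) ω) (outcomes X (duelsAt K (t + 1)) ω) ∂μ := by
    refine integral_congr_ae (Filter.Eventually.of_forall fun ω => ?_)
    simp only [φ, hS, outcomes, btwrAux]
  have e2 : ∀ q, ∫ ω, φ q (outcomes X (duelsAt K (t + 1)) ω) ∂μ =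
      E.p m (S q).incumbent (S q).challenger * V ((S q).step ℓ true) +
        (1 - E.p m (S q).incumbent (S q).challenger) * V ((S q).step ℓ false) := fun q =>
    integral_comp_bool (hmodel.measurable_X _ _ _) (E.p_mem m _ _).1
      (hmodel.law_X m _ ht _ _) fun x => V ((S q).step ℓ x)
  rw [e1, integral_comp_of_indepFun hU (measurable_outcomes hmodel _) (hmodel.indepFun_past t) φ,
    ← le_sub_iff_add_le, ← integral_sub (hmodel.integrable_btwrAux hK ℓ V t)
      (hmodel.integrable_btwrAux hK ℓ r t)]
  simp only [e2, hS]
  exact integral_mono (hmodel.integrable_btwrAux hK ℓ (fun s =>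
    E.p m s.incumbent s.challenger * V (s.step ℓ true) +
      (1 - E.p m s.incumbent s.challenger) * V (s.step ℓ false)) t)
    ((hmodel.integrable_btwrAux hK ℓ V t).sub (hmodel.integrable_btwrAux hK ℓ r t))
    fun ω => hdrift _ _

end Model

/-! ### Gaps and time steps -/

namespace Problem

variable {K M T : ℕ} (E : Problem K M T)

theorem p_self (m : Fin M) (i : Fin K) : E.p m i i = 1 / 2 := by
  have := E.p_add m i i
  linarith

theorem gap_best (m : Fin M) : E.gap m (E.best m) = 0 := by
  rw [gap, p_self, sub_self]

theorem gap_le_half (m : Fin M) (i : Fin K) : E.gap m i ≤ 1 / 2 := by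
  have := (E.p_mem m (E.best m) i).2
  unfold gap
  linarith

theorem minGap_le {m : Fin M} {i : Fin K} (h : i ≠ E.best m) : E.minGap ≤ E.gap m i :=
  ciInf_le (f := fun q : {q : Fin M × Fin K // q.2 ≠ E.best q.1} => E.gap q.1.1 q.1.2)
    (Set.finite_range _).bddBelow ⟨(m, i), h⟩

theorem nonempty_suboptimal (hK : 2 ≤ K) (hM : 1 ≤ M) :
    Nonempty {q : Fin M × Fin K // q.2 ≠ E.best q.1} := by
  have : Nontrivial (Fin K) := Fin.nontrivial_iff_two_le.2 hK
  obtain ⟨i, hi⟩ := exists_ne (E.best ⟨0, hM⟩)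
  exact ⟨⟨(⟨0, hM⟩, i), hi⟩⟩

theorem minGap_pos (hK : 2 ≤ K) (hM : 1 ≤ M) : 0 < E.minGap := by
  have := E.nonempty_suboptimal hK hM
  obtain ⟨q, hq⟩ := exists_eq_ciInf_of_finite
    (f := fun q : {q : Fin M × Fin K // q.2 ≠ E.best q.1} => E.gap q.1.1 q.1.2)
  rw [minGap, ← hq]
  exact sub_pos.2 (E.best_spec _ _ q.2)

theorem minGap_le_half (hK : 2 ≤ K) (hM : 1 ≤ M) : E.minGap ≤ 1 / 2 := by
  obtain ⟨q⟩ := E.nonempty_suboptimal hK hM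
  exact (E.minGap_le q.2).trans (E.gap_le_half _ _)

theorem binaryWeakRegret_le_misses (m : Fin M) (s : BtWRState K) :
    E.binaryWeakRegret m s.incumbent s.challenger ≤ BtWRState.misses (E.best m) s := by
  unfold binaryWeakRegret BtWRState.misses
  split_ifs with h
  · have : min (E.gap m s.incumbent) (E.gap m s.challenger) ≤ 0 := by
      rcases h with h | h
      · rw [h, gap_best]
        exact min_le_left _ _
      · rw [h, gap_best]
        exact min_le_right _ _
    exact_mod_cast Int.ceil_le.2 (by simpa using this)
  · have : min (E.gap m s.incumbent) (E.gap m s.challenger) ≤ 1 :=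
      (min_le_left _ _).trans ((E.gap_le_half _ _).trans (by norm_num))
    exact_mod_cast Int.ceil_le.2 (by simpa using this)

theorem one_le_of_mem_segment {m : Fin M} {t : ℕ} (ht : t ∈ E.segment m) : 1 ≤ t := by
  have h1 := E.ν_strictMono.monotone (Fin.zero_le m.castSucc)
  rw [E.ν_zero] at h1
  exact h1.trans (Finset.mem_Ico.1 ht).1

theorem le_of_mem_segment {m : Fin M} {t : ℕ} (ht : t ∈ E.segment m) : t ≤ T := by
  have h1 := E.ν_strictMono.monotone (Fin.le_last m.succ)
  rw [E.ν_last] at h1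
  have := (Finset.mem_Ico.1 ht).2
  omega

theorem one_le_horizon {K M T : ℕ} (E : Problem K M T) (hM : 1 ≤ M) : 1 ≤ T := by
  have h := E.ν_strictMono (show (0 : Fin (M + 1)) < Fin.last M from
    Fin.lt_def.2 (by simp; omega))
  rw [E.ν_zero, E.ν_last] at h
  omega

end Problem

/-! ### Estimates for the round lengths -/

section RoundLength

variable {Δ : ℝ}

theorem log_roundLength_arg {c : ℕ} (hc : 1 ≤ c) :
    Real.log ((c : ℝ) * ((c : ℝ) + 1) * Real.exp 1 / (1 / Real.exp 1)) =
      Real.log ((c : ℝ) * ((c : ℝ) + 1)) + 2 := by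
  have hc' : (0 : ℝ) < c := by exact_mod_cast hc
  have h : (c : ℝ) * ((c : ℝ) + 1) * Real.exp 1 / (1 / Real.exp 1) =
      (c : ℝ) * ((c : ℝ) + 1) * Real.exp 2 := by
    rw [div_div_eq_mul_div, div_one, mul_assoc, ← Real.exp_add]
    norm_num
  rw [h, Real.log_mul (by positivity) (Real.exp_pos _).ne', Real.log_exp]

theorem log_mul_succ_nonneg {c : ℕ} (hc : 1 ≤ c) : 0 ≤ Real.log ((c : ℝ) * ((c : ℝ) + 1)) := by
  have hc' : (1 : ℝ) ≤ c := by exact_mod_cast hc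
  exact Real.log_nonneg (by nlinarith)

theorem two_le_roundLength_arg (h0 : 0 < Δ) (h1 : Δ ≤ 1 / 2) {c : ℕ} (hc : 1 ≤ c) :
    2 ≤ 1 / (4 * Δ ^ 2) *
      Real.log ((c : ℝ) * ((c : ℝ) + 1) * Real.exp 1 / (1 / Real.exp 1)) := by
  rw [log_roundLength_arg hc]
  have h2 : 1 ≤ 1 / (4 * Δ ^ 2) := (one_le_div (by positivity)).2 (by nlinarith)
  have := log_mul_succ_nonneg hc
  nlinarith

theorem roundLength_pos (h0 : 0 < Δ) (h1 : Δ ≤ 1 / 2) (c : ℕ) (hc : 1 ≤ c) :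
    0 < roundLength Δ (1 / Real.exp 1) c := by
  have := two_le_roundLength_arg h0 h1 hc
  exact Nat.ceil_pos.2 (by linarith)

/-- Since `1 - x ≤ exp (-x)`, the power is at most `exp (-4 Δ² ℓ)`. With `δ = 1/e` the logarithm
contributes an extra `2`, and the `-1/2` in the round length costs `2 Δ² ≤ 1/2`. The remaining `exp
(-3/2) ≤ 1/4` gives the factor `4`. -/
theorem pow_roundLength_le (h0 : 0 < Δ) (h1 : Δ ≤ 1 / 2) (c : ℕ) (hc : 1 ≤ c) :
    (1 - (2 * Δ) ^ 2) ^ roundLength Δ (1 / Real.exp 1) c ≤ 1 / (4 * ((c : ℝ) * (c + 1))) := by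
  have hc' : (0 : ℝ) < c := by exact_mod_cast hc
  set n := roundLength Δ (1 / Real.exp 1) c with hn
  have hceil : 1 / (4 * Δ ^ 2) * (Real.log ((c : ℝ) * ((c : ℝ) + 1)) + 2) - 1 / 2 ≤ n := by
    rw [← log_roundLength_arg hc]
    exact Nat.le_ceil _
  have h4 : (0 : ℝ) < 4 * Δ ^ 2 := by positivity
  have h5 : Real.log ((c : ℝ) * ((c : ℝ) + 1)) + 3 / 2 ≤ 4 * Δ ^ 2 * n := by
    have := mul_le_mul_of_nonneg_left hceil h4.le
    rw [mul_sub, ← mul_assoc, mul_one_div_cancel h4.ne', one_mul] at this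
    nlinarith
  have h6 : 4 ≤ Real.exp (3 / 2) := by
    have e : Real.exp (3 / 2) = Real.exp 1 * Real.exp (1 / 2) := by
      rw [← Real.exp_add]
      norm_num
    have := Real.exp_one_gt_d9
    have := Real.add_one_le_exp (1 / 2 : ℝ)
    rw [e]
    nlinarith
  have h7 : 0 ≤ 1 - (2 * Δ) ^ 2 := by nlinarith
  calc (1 - (2 * Δ) ^ 2) ^ n ≤ Real.exp (-(2 * Δ) ^ 2) ^ n :=
        pow_le_pow_left₀ h7 (by have := Real.add_one_le_exp (-(2 * Δ) ^ 2); linarith) n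
    _ = Real.exp (-(4 * Δ ^ 2 * n)) := by
        rw [← Real.exp_nat_mul]
        congr 1
        ring
    _ ≤ Real.exp (-(Real.log ((c : ℝ) * ((c : ℝ) + 1)) + 3 / 2)) :=
        Real.exp_le_exp.2 (neg_le_neg h5)
    _ = 1 / (Real.exp (3 / 2) * ((c : ℝ) * (c + 1))) := by
        rw [Real.exp_neg, Real.exp_add, Real.exp_log (by positivity), one_div, mul_comm]
    _ ≤ _ := one_div_le_one_div_of_le (by positivity) (by gcongr)

theorem two_mul_roundLength_le (h0 : 0 < Δ) (h1 : Δ ≤ 1 / 2) {n : ℝ} (hn : Real.exp 1 ≤ n)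
    (c : ℕ) (hcn : (c : ℝ) + 1 ≤ n) :
    2 * (roundLength Δ (1 / Real.exp 1) c : ℝ) - 1 ≤ 2 * Real.log n / Δ ^ 2 := by
  have hn0 : 0 < n := (Real.exp_pos 1).trans_le hn
  have hlogn : 1 ≤ Real.log n := (Real.le_log_iff_exp_le hn0).2 hn
  rcases Nat.eq_zero_or_pos c with rfl | hc
  · have : 0 ≤ 2 * Real.log n / Δ ^ 2 := by positivity
    have : roundLength Δ (1 / Real.exp 1) 0 = 0 := by
      simp [roundLength]
    rw [this]
    push_cast
    linarith
  have hc' : (0 : ℝ) < c := by exact_mod_cast hc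
  have h2 := two_le_roundLength_arg h0 h1 hc
  -- The ceiling loses less than `1`, so `2ℓ - 1` stays below twice the unshifted argument: the
  -- `-1/2` and the `-1` cancel the rounding.
  have h3 := Nat.ceil_lt_add_one (a := 1 / (4 * Δ ^ 2) *
      Real.log ((c : ℝ) * ((c : ℝ) + 1) * Real.exp 1 / (1 / Real.exp 1)) - 1 / 2) (by linarith)
  have h4 : Real.log ((c : ℝ) * ((c : ℝ) + 1)) ≤ 2 * Real.log n := by
    rw [Real.log_mul hc'.ne' (by positivity)]
    have := Real.log_le_log hc' (show (c : ℝ) ≤ n by linarith)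
    have := Real.log_le_log (by positivity) hcn
    linarith
  rw [log_roundLength_arg hc] at h3
  have h5 : 1 / (4 * Δ ^ 2) * (Real.log ((c : ℝ) * ((c : ℝ) + 1)) + 2) ≤
      1 / (4 * Δ ^ 2) * (4 * Real.log n) :=
    mul_le_mul_of_nonneg_left (by linarith) (by positivity)
  have h6 : 2 * Real.log n / Δ ^ 2 = 2 * (1 / (4 * Δ ^ 2) * (4 * Real.log n)) := by
    field_simp
  rw [h6]
  unfold roundLength
  rw [log_roundLength_arg hc]
  linarith

end RoundLength

/-! ### Regret per segment and in total -/

section Regret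

variable {K M T : ℕ} {E : Problem K M T} {Ω : Type*} [MeasurableSpace Ω] {μ : Measure Ω}
  [IsProbabilityMeasure μ] {σ : Ω → Equiv.Perm (Fin K)} {X : ℕ → Fin K → Fin K → Ω → Bool}

theorem IsModel.sum_misses_le (hmodel : IsModel E μ σ X) (hK : 2 ≤ K) (hM : 1 ≤ M) (m : Fin M) :
    ∑ t ∈ E.segment m, ∫ ω, BtWRState.misses (E.best m)
        (btwr hK (roundLength E.minGap (1 / Real.exp 1)) (σ ω) (fun t i j => X t i j ω) t) ∂μ ≤
      2 * (((K : ℝ) - 2) * (2 * Real.log ((K : ℝ) + T) / E.minGap ^ 2)) := by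
  set ℓ := roundLength E.minGap (1 / Real.exp 1)
  set L := 2 * Real.log ((K : ℝ) + T) / E.minGap ^ 2 with hLdef
  set B := 8 / 5 * (((K : ℝ) - 2) * L) with hB
  have hΔ0 := E.minGap_pos hK hM
  have hΔ1 := E.minGap_le_half hK hM
  have hK' : (2 : ℝ) ≤ K := by exact_mod_cast hK
  have hT' : (1 : ℝ) ≤ T := by exact_mod_cast E.one_le_horizon hM
  have hlog : 0 ≤ Real.log ((K : ℝ) + T) := Real.log_nonneg (by linarith)
  have hL0 : 0 ≤ L := by positivity
  have hB0 : 0 ≤ B := by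
    have : (0 : ℝ) ≤ K - 2 := by linarith
    positivity
  have hℓ := roundLength_pos hΔ0 hΔ1
  -- Up to time `T` the counter is at most `T + 1`, and `K ≥ 2` gives `c + 1 ≤ K + T`; also `e < 3 ≤
  -- K + T`.
  have hL : ∀ c, c ≤ T + 1 → 2 * (ℓ c : ℝ) - 1 ≤ L := fun c hc =>
    two_mul_roundLength_le hΔ0 hΔ1 (by have := Real.exp_one_lt_d9; linarith) c (by
      have : (c : ℝ) ≤ T + 1 := by exact_mod_cast hc
      linarith)
  let V : BtWRState K → ℝ := BtWRState.potential ℓ (2 * E.minGap) L B (E.best m)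
  let v : ℕ → ℝ := fun t => ∫ ω, V (btwrAux hK ℓ (σ ω) (fun t i j => X t i j ω) t) ∂μ
  have hstep : ∀ t, t + 1 ∈ E.segment m → v (t + 1) + ∫ ω, BtWRState.misses (E.best m)
      (btwrAux hK ℓ (σ ω) (fun t i j => X t i j ω) t) ∂μ ≤ v t := by
    intro t ht
    refine hmodel.integral_step_le hK ht fun τ x => ?_
    have htT := E.le_of_mem_segment ht
    refine BtWRState.potential_drift (N := t + 1) (by linarith) (by linarith) hL0 hB
      (pow_roundLength_le hΔ0 hΔ1) (fun c hc => hL c (by omega)) (E.p_mem m) (E.p_add m) ?_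
      (valid_btwrAux hK hℓ τ x t)
    intro i hi
    have := E.minGap_le hi
    unfold Problem.gap at this
    linarith
  have hv0 : ∀ t, 0 ≤ v t := fun t => integral_nonneg fun ω =>
    BtWRState.potential_nonneg (by linarith) (by linarith) hL0 hB0 (valid_btwrAux hK hℓ _ _ t)
  have hv1 : ∀ t, t ≤ T → v t ≤ 2 * (((K : ℝ) - 2) * L) := by
    intro t ht
    have h := integral_mono (hmodel.integrable_btwrAux hK ℓ V t)
      (integrable_const (2 * (((K : ℝ) - 2) * L))) fun ω =>
        BtWRState.potential_le (d := 2 * E.minGap) (b := E.best m) hL0 hB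
          (fun c hc => hL c (by omega)) (valid_btwrAux hK hℓ (σ ω) (fun t i j => X t i j ω) t)
    simpa using h
  have h1 : ∀ t ∈ E.segment m, ∫ ω, BtWRState.misses (E.best m)
      (btwr hK ℓ (σ ω) (fun t i j => X t i j ω) t) ∂μ ≤ v (t - 1) - v t := by
    intro t ht
    obtain ⟨u, rfl⟩ : ∃ u, t = u + 1 := ⟨t - 1, by have := E.one_le_of_mem_segment ht; omega⟩
    have := hstep u ht
    simp only [btwr, Nat.add_sub_cancel]
    linarith
  refine (Finset.sum_le_sum h1).trans ?_
  have hlt : E.ν m.castSucc < E.ν m.succ := E.ν_strictMono m.castSucc_lt_succ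
  have hmem : E.ν m.castSucc ∈ E.segment m := Finset.left_mem_Ico.2 hlt
  have h2 : ∀ b, E.ν m.castSucc ≤ b → ∑ t ∈ Finset.Ico (E.ν m.castSucc) b, (v (t - 1) - v t) =
      v (E.ν m.castSucc - 1) - v (b - 1) := by
    intro b hb
    induction b, hb using Nat.le_induction with
    | base => simp
    | succ b hb ih =>
      rw [Finset.sum_Ico_succ_top hb, ih]
      simp
  -- The state entering the segment is arbitrary, so the uniform bound on the potential is used.
  have h3 := hv1 (E.ν m.castSucc - 1) (by have := E.le_of_mem_segment hmem; omega)
  have h4 := hv0 (E.ν m.succ - 1)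
  rw [Problem.segment, h2 _ hlt.le]
  linarith

end Regret

end DuelingBandits

theorem theorem2 {K M T : ℕ} (hK : 2 ≤ K) (hM : 1 ≤ M) (E : DuelingBandits.Problem K M T)
    {Ω : Type*} [MeasurableSpace Ω] (μ : MeasureTheory.Measure Ω)
    [MeasureTheory.IsProbabilityMeasure μ]
    (σ : Ω → Equiv.Perm (Fin K)) (X : ℕ → Fin K → Fin K → Ω → Bool)
    (hmodel : DuelingBandits.IsModel E μ σ X)
    (R : Ω → ℝ)
    (hR : R = fun ω => E.btwrRegret hK
      (DuelingBandits.roundLength E.minGap (1 / Real.exp 1)) (σ ω) (fun t i j => X t i j ω)) :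
    MeasureTheory.Integrable R μ ∧
      ∫ ω, R ω ∂μ ≤
        21 * (K : ℝ) * (M : ℝ) / E.minGap ^ 2 * Real.log ((K : ℝ) + (T : ℝ)) := by
  subst hR
  have hΔ0 := E.minGap_pos hK hM
  have hint : ∀ m, ∀ t ∈ E.segment m, MeasureTheory.Integrable (fun ω => E.binaryWeakRegret m
      (DuelingBandits.btwr hK (DuelingBandits.roundLength E.minGap (1 / Real.exp 1)) (σ ω)
        (fun t i j => X t i j ω) t).incumbent
      (DuelingBandits.btwr hK (DuelingBandits.roundLength E.minGap (1 / Real.exp 1)) (σ ω)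
        (fun t i j => X t i j ω) t).challenger) μ := fun m t _ =>
    hmodel.integrable_btwrAux hK _
      (fun s => E.binaryWeakRegret m s.incumbent s.challenger) (t - 1)
  refine ⟨MeasureTheory.integrable_finsetSum _ fun m _ =>
    MeasureTheory.integrable_finsetSum _ (hint m), ?_⟩
  have hK' : (2 : ℝ) ≤ K := by exact_mod_cast hK
  have hT' : (0 : ℝ) ≤ T := Nat.cast_nonneg T
  have hlog : 0 ≤ Real.log ((K : ℝ) + T) := Real.log_nonneg (by linarith)
  calc _ = ∑ m : Fin M, ∑ t ∈ E.segment m, ∫ ω, E.binaryWeakRegret m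
        (DuelingBandits.btwr hK (DuelingBandits.roundLength E.minGap (1 / Real.exp 1)) (σ ω)
          (fun t i j => X t i j ω) t).incumbent
        (DuelingBandits.btwr hK (DuelingBandits.roundLength E.minGap (1 / Real.exp 1)) (σ ω)
          (fun t i j => X t i j ω) t).challenger ∂μ := by
        unfold DuelingBandits.Problem.btwrRegret
        rw [MeasureTheory.integral_finsetSum _ fun m _ =>
          MeasureTheory.integrable_finsetSum _ (hint m)]
        exact Finset.sum_congr rfl fun m _ => MeasureTheory.integral_finsetSum _ (hint m)
    _ ≤ ∑ m : Fin M, 2 * (((K : ℝ) - 2) * (2 * Real.log ((K : ℝ) + T) / E.minGap ^ 2)) := by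
        refine Finset.sum_le_sum fun m _ => le_trans (Finset.sum_le_sum fun t ht => ?_)
          (hmodel.sum_misses_le hK hM m)
        exact MeasureTheory.integral_mono (hint m t ht)
          (hmodel.integrable_btwrAux hK _ (DuelingBandits.BtWRState.misses (E.best m)) (t - 1))
          fun ω => E.binaryWeakRegret_le_misses m _
    _ = 4 * ((K : ℝ) - 2) * M / E.minGap ^ 2 * Real.log ((K : ℝ) + T) := by
        rw [Finset.sum_const, Finset.card_univ, Fintype.card_fin, nsmul_eq_mul]
        ring
    _ ≤ _ := by
        -- The potential argument yields `4 (K - 2)`, well within the claimed `21 K`.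
        have : 4 * ((K : ℝ) - 2) ≤ 21 * K := by linarith
        gcongr
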